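/- Let $n\ge 2$ and $d=n-2$. Regard $d$-dimensional Euclidean, hyperbolic and elliptic geometry as subgeometries of real projective space $\mathbb{RP}^d$: a Euclidean point $x\in\mathbb R^d$ is the point $[1:x]$; hyperbolic space is the hyperboloid $\{x\in\mathbb R^{d+1}: -x_0^2+x_1^2+\dots+x_d^2=-1,\ x_0>0\}$, a point $x$ of it being the projective point $[x]$; the elliptic points are all points of $\mathbb{RP}^d$, each being $[x]=[-x]$ for a unit vector $x\in S^d$. Let $N^{(1)},N^{(2)},\dots$ be $n$-tuples $N^{(j)}=(V^{(j)}_1,\dots,V^{(j)}_n)$ of points obtained by the generalized perpendicular bisector construction: for each $i$, the point $V_i^{(j+1)}$ is the center of the hypersphere through the $n-1$ points $V_l^{(j)}$, $l\neq i$. In hyperbolic geometry the centers are required to be (ordinary) points of the hyperbolic space. In elliptic geometry, where a pair of points has two mediators and $n-1$ points lie on several hyperspheres, one mediator is fixed consistently for each pair of points, as follows: at each stage unit representatives $x^{(j)}_l\in S^d$ of the points $V^{(j)}_l$ are fixed, and $V_i^{(j+1)}$ is represented by either of the two (antipodal) spherical centers of the hypersphere of $S^d$ through the $x^{(j)}_l$,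 $l\ne i$. Let $k\ge1$. Suppose that $N^{(1)}$ is nondegenerate, i.e. any $n-1$ of its points are affinely independent (in the non-Euclidean cases: projectively independent); that none of $N^{(1)},\dots,N^{(k)}$ is conhyperspherical, i.e. contained in one hypersphere (in the elliptic case: the representatives $x^{(j)}_1,\dots,x^{(j)}_n$ are not contained in one hypersphere of $S^d$); and that $N^{(2)},\dots,N^{(k+2)}$ are constructed successively as above. Then, in each of the three geometries, $N^{(k)}$ and $N^{(k+2)}$ are perspective in a point: there is a point $W\in\mathbb{RP}^d$ (possibly not an ordinary point of the geometry) such that for every $i$ with $V_i^{(k)}\ne V_i^{(k+2)}$ the line $V_i^{(k)}V_i^{(k+2)}$ passes through $W$. -/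

import Mathlib

open scoped LinearAlgebra.Projectivization

noncomputable section

/-- Real projective `d`-space, in homogeneous coordinates `x 0, …, x d`. -/
abbrev RealProj (d : ℕ) : Type := ℙ ℝ (EuclideanSpace ℝ (Fin (d + 1)))

/-! ### Hyperspheres and the construction, for an arbitrary distance function -/

/-- All the points of `P` lie on one hypersphere `{x | δ x c = r}`. -/
def Conhyperspherical {X ι : Type*} (δ : X → X → ℝ) (P : ι → X) : Prop :=
  ∃ (c : X) (r : ℝ), ∀ j, δ (P j) c = r

/-- One step of the construction: every `Q i` is a centre of a hypersphere through all the points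
`P j` with `j ≠ i`. -/
def IsNextGeneration {X ι : Type*} (δ : X → X → ℝ) (P Q : ι → X) : Prop :=
  ∀ i, ∃ r : ℝ, ∀ j, j ≠ i → δ (P j) (Q i) = r

/-! ### Projective notions -/

/-- The points of `P` are in general position: whichever point is omitted, the remaining ones are
projectively independent (for `d + 2` points in projective `d`-space: no `d + 1` of them lie on a
hyperplane). -/
def ProjNondegenerate {d : ℕ} {ι : Type*} (P : ι → RealProj d) : Prop :=
  ∀ i, Projectivization.Independent (fun j : {j : ι // j ≠ i} => P j)

/-- `P` and `Q` are in perspective from a single point `W` of projective space: for every `i` such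
that `P i` and `Q i` are distinct, the line joining `P i` to `Q i` passes through `W`. -/
def PerspectiveInPoint {d : ℕ} {ι : Type*} (P Q : ι → RealProj d) : Prop :=
  ∃ W : RealProj d, ∀ i, P i ≠ Q i → W.submodule ≤ (P i).submodule ⊔ (Q i).submodule

/-! ### Euclidean geometry -/

/-- Whichever point of `P` is omitted, the remaining ones are affinely independent. -/
def AffNondegenerate {d : ℕ} {ι : Type*} (P : ι → EuclideanSpace ℝ (Fin d)) : Prop :=
  ∀ i, AffineIndependent ℝ (fun j : {j : ι // j ≠ i} => P j)

/-- The homogeneous coordinates `(1, x)` of a point `x` of Euclidean space. -/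
def homogenize {d : ℕ} (x : EuclideanSpace ℝ (Fin d)) : EuclideanSpace ℝ (Fin (d + 1)) :=
  WithLp.toLp 2 (Fin.cons 1 (fun i => x i))

theorem homogenize_ne_zero {d : ℕ} (x : EuclideanSpace ℝ (Fin d)) : homogenize x ≠ 0 := by
  intro h
  have h0 := congrArg (fun v : EuclideanSpace ℝ (Fin (d + 1)) => v 0) h
  simp [homogenize] at h0

/-- Euclidean space as the part of projective space off the ideal hyperplane `x 0 = 0`. -/
def euclToProj {d : ℕ} (x : EuclideanSpace ℝ (Fin d)) : RealProj d :=
  Projectivization.mk ℝ (homogenize x) (homogenize_ne_zero x)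

/-! ### Hyperbolic geometry -/

/-- The Lorentz form `-x₀y₀ + x₁y₁ + ⋯ + x_d y_d`. -/
def lorentz {d : ℕ} (x y : EuclideanSpace ℝ (Fin (d + 1))) : ℝ :=
  -(x 0 * y 0) + ∑ i : Fin d, x i.succ * y i.succ

/-- Hyperbolic `d`-space, as the upper sheet of the hyperboloid. -/
def HypSpace (d : ℕ) : Type :=
  {x : EuclideanSpace ℝ (Fin (d + 1)) // lorentz x x = -1 ∧ 0 < x 0}

/-- The hyperbolic distance: `cosh (hypDist x y) = -lorentz x y`. -/
def hypDist {d : ℕ} (x y : HypSpace d) : ℝ :=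
  Real.arcosh (-lorentz x.1 y.1)

theorem HypSpace.coe_ne_zero {d : ℕ} (x : HypSpace d) : x.1 ≠ 0 := by
  intro h
  have h0 := x.2.2
  rw [h] at h0
  simp at h0

/-- Hyperbolic space as the interior of the quadric `lorentz x x = 0` in projective space. -/
def hypToProj {d : ℕ} (x : HypSpace d) : RealProj d :=
  Projectivization.mk ℝ x.1 x.coe_ne_zero

/-! ### Elliptic geometry

The points of elliptic `d`-space are all the points of projective `d`-space; each of them has two
unit representatives `±x` on the sphere `S^d`, and the elliptic hyperspheres are the images of the
hyperspheres of `S^d`. Through `d + 1` independent elliptic points there pass `2 ^ d` hyperspheres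
(two points have two midpoints, hence two mediators). Choosing unit representatives of the points
singles out one mediator for every pair of points and one hypersphere for every `d + 1` of them. -/

/-- The unit sphere `S^d`. -/
abbrev UnitSphere (d : ℕ) : Type :=
  Metric.sphere (0 : EuclideanSpace ℝ (Fin (d + 1))) 1

/-- The spherical distance on `S^d`. -/
def sphDist {d : ℕ} (x y : UnitSphere d) : ℝ :=
  InnerProductGeometry.angle x.1 y.1

theorem UnitSphere.coe_ne_zero {d : ℕ} (x : UnitSphere d) : x.1 ≠ 0 :=
  ne_zero_of_mem_unit_sphere x

/-- The elliptic point represented by the unit vector `x`. -/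
def ellToProj {d : ℕ} (x : UnitSphere d) : RealProj d :=
  Projectivization.mk ℝ x.1 (UnitSphere.coe_ne_zero x)

end

open LinearMap (BilinForm)

section LinearAlgebra

variable {ι V : Type*} [AddCommGroup V] [Module ℝ V]

/-- Whichever vector is omitted, the remaining ones are linearly independent: a linear relation
with a vanishing coefficient is trivial. -/
def RelNondegenerate [Fintype ι] (x : ι → V) : Prop :=
  ∀ μ : ι → ℝ, ∑ i, μ i • x i = 0 → ∀ i, μ i = 0 → μ = 0

theorem RelNondegenerate.exists_rel [Fintype ι] [FiniteDimensional ℝ V] {x : ι → V}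
    (hx : RelNondegenerate x) (hcard : Module.finrank ℝ V + 1 = Fintype.card ι) :
    ∃ μ : ι → ℝ, ∑ i, μ i • x i = 0 ∧ ∀ i, μ i ≠ 0 := by
  have hdep : ¬ LinearIndependent ℝ x := fun h => by
    have := h.fintype_card_le_finrank
    omega
  rw [Fintype.not_linearIndependent_iff] at hdep
  obtain ⟨μ, hμ, i, hi⟩ := hdep
  exact ⟨μ, hμ, fun j hj => hi (congrFun (hx μ hμ j hj) i)⟩

theorem RelNondegenerate.functional_eq_zero [Fintype ι] [FiniteDimensional ℝ V] {x : ι → V}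
    (hx : RelNondegenerate x) (hcard : Module.finrank ℝ V + 1 = Fintype.card ι)
    (f : V →ₗ[ℝ] ℝ) (hf : ∀ i, f (x i) = 0) : f = 0 := by
  classical
  obtain ⟨i₀⟩ : Nonempty ι := Fintype.card_pos_iff.mp (by omega)
  have hind : LinearIndependent ℝ (fun j : {j : ι // j ≠ i₀} => x j) := by
    rw [Fintype.linearIndependent_iff]
    intro g hg
    have key := hx (fun i => if h : i ≠ i₀ then g ⟨i, h⟩ else 0) (by
      rw [Fintype.sum_eq_add_sum_subtype_ne _ i₀, ← hg]
      simp only [ne_eq, not_true_eq_false, dite_false, zero_smul, zero_add]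
      exact Finset.sum_congr rfl fun j _ => by rw [dif_pos j.2]) i₀ (by simp)
    intro j
    have := congrFun key j
    simpa [j.2] using this
  have hspan := hind.span_eq_top_of_card_eq_finrank' (by
    rw [Fintype.card_subtype_compl, Fintype.card_subtype_eq]; omega)
  refine LinearMap.ext_on_range (v := fun j : {j : ι // j ≠ i₀} => x j) hspan ?_
  intro j
  simpa using hf j

theorem relNondegenerate_of_forall_functional [Fintype ι] {x : ι → V} {F : ι → V →ₗ[ℝ] ℝ}
    {a : ι → ℝ} {e : ι → ℝ} [DecidableEq ι] (he : ∀ i, e i ≠ 0)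
    (hF : ∀ i j, F j (x i) = a i + if j = i then e i else 0) : RelNondegenerate x := by
  intro μ hμ i hi
  have key : ∀ j, ∑ i, μ i * a i + μ j * e j = 0 := by
    intro j
    have := congrArg (F j) hμ
    simpa [hF, mul_add, Finset.sum_add_distrib] using this
  have h0 : ∑ i, μ i * a i = 0 := by simpa [hi] using key i
  funext j
  simpa [h0, he j] using key j

/-- Linear-algebra form of perspectivity of two families of vectors, as families of projective
points. -/
def LinePerspective (x z : ι → V) : Prop :=
  ∃ w : V, w ≠ 0 ∧ ∀ i, x i ∈ Submodule.span ℝ {z i} ∨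
    w ∈ Submodule.span ℝ {x i} ⊔ Submodule.span ℝ {z i}

theorem linePerspective_of_forall_smul_eq {x z : ι → V} (i₀ : ι) (hz : z i₀ ≠ 0)
    (h : ∀ i, ∃ t : ℝ, z i₀ = t • z i) : LinePerspective x z :=
  ⟨z i₀, hz, fun i => by
    obtain ⟨t, ht⟩ := h i
    exact .inr (Submodule.mem_sup_right (Submodule.mem_span_singleton.2 ⟨t, ht.symm⟩))⟩

theorem linePerspective_of_add_smul_eq {x z : ι → V} (i₀ : ι) (hz : z i₀ ≠ 0) (β : ι → ℝ)
    (h : ∀ i, x i + β i • z i = x i₀ + β i₀ • z i₀) : LinePerspective x z := by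
  by_cases hw : x i₀ + β i₀ • z i₀ = 0
  · refine ⟨z i₀, hz, fun i => .inl (Submodule.mem_span_singleton.2 ⟨-β i, ?_⟩)⟩
    rw [neg_smul, ← eq_neg_of_add_eq_zero_left ((h i).trans hw)]
  · refine ⟨_, hw, fun i => .inr ?_⟩
    rw [← h i]
    exact Submodule.add_mem_sup (Submodule.mem_span_singleton_self _)
      (Submodule.smul_mem _ _ (Submodule.mem_span_singleton_self _))

/-- Two steps of the construction in the projective model of a non-Euclidean geometry whose
absolute is given by a nondegenerate symmetric bilinear form `B`. -/
theorem linePerspective_of_bilinForm [Fintype ι] [FiniteDimensional ℝ V] [DecidableEq ι]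
    {B : BilinForm ℝ V} (hsymm : ∀ u v, B u v = B v u) (hnd : ∀ v, B v = 0 → v = 0)
    (hcard : Module.finrank ℝ V + 1 = Fintype.card ι) {x y z : ι → V} {c e b f : ι → ℝ}
    (he : ∀ i, e i ≠ 0) (hz : ∀ i, z i ≠ 0)
    (hxy : ∀ i j, B (x j) (y i) = c i + if j = i then e i else 0)
    (hyz : ∀ i j, B (y j) (z i) = b i + if j = i then f i else 0) : LinePerspective x z := by
  obtain ⟨i₀⟩ : Nonempty ι := Fintype.card_pos_iff.mp (by omega)
  have hy : RelNondegenerate y :=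
    relNondegenerate_of_forall_functional (F := fun j => B (x j)) he hxy
  have hext : ∀ u v, (∀ j, B (y j) u = B (y j) v) → u = v := by
    intro u v h
    refine sub_eq_zero.1 (hnd _ (hy.functional_eq_zero hcard _ fun j => ?_))
    rw [hsymm, map_sub, h, sub_self]
  obtain ⟨μ, hμ, hμ0⟩ := hy.exists_rel hcard
  have h1 : ∀ j, ∑ i, μ i * c i + μ j * e j = 0 := by
    intro j
    have := congrArg (B (x j)) hμ
    simpa [hxy, mul_add, Finset.sum_add_distrib] using this
  have h2 : ∀ i, (∑ j, μ j) * b i + μ i * f i = 0 := by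
    intro i
    have := congrArg (B (z i)) hμ
    simpa [hsymm (z i), hyz, mul_add, Finset.sum_add_distrib, Finset.sum_mul] using this
  have hbf : ∀ i, f i = 0 → b i ≠ 0 := by
    intro i hf hb
    refine hz i (hext _ _ fun j => ?_)
    simp [hyz, hf, hb]
  by_cases hM : ∑ j, μ j = 0
  · have hf : ∀ i, f i = 0 := fun i => by simpa [hM, hμ0 i] using h2 i
    refine linePerspective_of_forall_smul_eq i₀ (hz i₀) fun i => ⟨b i₀ / b i, hext _ _ fun j => ?_⟩
    have := hbf i (hf i)
    simp [hyz, hf, this]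
  · have hf : ∀ i, f i ≠ 0 := fun i hf => hbf i hf (by simpa [hM, hf] using h2 i)
    refine linePerspective_of_add_smul_eq i₀ (hz i₀) (fun i => -e i / f i) fun i => ?_
    have key : ∀ i j, B (y j) (x i + (-e i / f i) • z i)
        = c j - (∑ k, μ k * c k) / ∑ k, μ k := by
      intro i j
      have hb : e i / f i * b i = (∑ k, μ k * c k) / ∑ k, μ k := by
        have := hf i
        field_simp
        apply mul_left_cancel₀ (hμ0 i)
        linear_combination μ i * e i * h2 i - μ i * f i * h1 i
      rw [map_add, map_smul, hsymm, hxy, hyz, ← hb]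
      have := hf i
      by_cases hij : i = j
      · subst hij
        simp
        field_simp
        ring
      · simp [hij, Ne.symm hij]
        ring
    exact hext _ _ fun j => by rw [key, key]

end LinearAlgebra

/-- A family whose values agree off `i` is a constant plus a correction at `i`. -/
theorem exists_eq_add_ite {ι : Type*} [DecidableEq ι] {g : ι → ι → ℝ}
    (h : ∀ i, ∃ r, ∀ j, j ≠ i → g i j = r) :
    ∃ c e : ι → ℝ, ∀ i j, g i j = c i + if j = i then e i else 0 := by
  choose c hc using h
  refine ⟨c, fun i => g i i - c i, fun i j => ?_⟩
  by_cases hij : j = i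
  · subst hij
    simp
  · simp [hij, hc i j hij]

theorem LinePerspective.perspectiveInPoint {d : ℕ} {ι : Type*}
    {x z : ι → EuclideanSpace ℝ (Fin (d + 1))} (h : LinePerspective x z) (hx : ∀ i, x i ≠ 0)
    (hz : ∀ i, z i ≠ 0) :
    PerspectiveInPoint (fun i => Projectivization.mk ℝ (x i) (hx i))
      (fun i => Projectivization.mk ℝ (z i) (hz i)) := by
  obtain ⟨w, hw, h⟩ := h
  refine ⟨Projectivization.mk ℝ w hw, fun i hi => ?_⟩
  simp only [Projectivization.submodule_mk, Submodule.span_singleton_le_iff_mem]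
  refine (h i).resolve_left fun hxz => hi ?_
  obtain ⟨a, ha⟩ := Submodule.mem_span_singleton.1 hxz
  exact (Projectivization.mk_eq_mk_iff' ℝ _ _ _ _).2 ⟨a, ha⟩

/-- Two steps of the construction for a distance that is an injective function of a nondegenerate
symmetric bilinear form. -/
theorem perspectiveInPoint_of_bilinForm {d : ℕ} {X : Type*} {δ : X → X → ℝ}
    {v : X → EuclideanSpace ℝ (Fin (d + 1))} (hv : ∀ p, v p ≠ 0)
    {B : BilinForm ℝ (EuclideanSpace ℝ (Fin (d + 1)))}
    (hsymm : ∀ u v, B u v = B v u) (hnd : ∀ v, B v = 0 → v = 0)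
    (hδ : ∀ p q p' q', δ p q = δ p' q' ↔ B (v p) (v q) = B (v p') (v q'))
    {P Q R : Fin (d + 2) → X} (hP : ¬ Conhyperspherical δ P) (hPQ : IsNextGeneration δ P Q)
    (hQR : IsNextGeneration δ Q R) :
    PerspectiveInPoint (fun i => Projectivization.mk ℝ (v (P i)) (hv _))
      (fun i => Projectivization.mk ℝ (v (R i)) (hv _)) := by
  have step : ∀ {P Q : Fin (d + 2) → X}, IsNextGeneration δ P Q →
      ∃ c e : Fin (d + 2) → ℝ, ∀ i j, B (v (P j)) (v (Q i)) = c i + if j = i then e i else 0 := by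
    intro P Q h
    refine exists_eq_add_ite (g := fun i j => B (v (P j)) (v (Q i))) fun i => ?_
    obtain ⟨r, hr⟩ := h i
    obtain ⟨k, hk⟩ := exists_ne i
    exact ⟨_, fun j hj => (hδ _ _ _ _).1 ((hr j hj).trans (hr k hk).symm)⟩
  obtain ⟨c, e, hce⟩ := step hPQ
  obtain ⟨b, f, hbf⟩ := step hQR
  refine (linePerspective_of_bilinForm hsymm hnd (by simp) (fun i hi => hP ?_)
    (fun i => hv (R i)) hce hbf).perspectiveInPoint (fun i => hv (P i)) (fun i => hv (R i))
  exact ⟨Q i, δ (P i) (Q i), fun j => (hδ _ _ _ _).2 (by simp [hce, hi])⟩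

/-! ### Euclidean geometry -/

theorem homogenize_zero {d : ℕ} (x : EuclideanSpace ℝ (Fin d)) : homogenize x 0 = 1 := rfl

theorem homogenize_succ {d : ℕ} (x : EuclideanSpace ℝ (Fin d)) (i : Fin d) :
    homogenize x i.succ = x i := rfl

/-- Up to the summand `‖y‖ ^ 2`, the squared distance of `x` and `y`, as a linear function of the
homogeneous coordinates of `y`. -/
noncomputable def sqDistFunctional {d : ℕ} (x : EuclideanSpace ℝ (Fin d)) :
    EuclideanSpace ℝ (Fin (d + 1)) →ₗ[ℝ] ℝ where
  toFun v := ‖x‖ ^ 2 * v 0 - 2 * ∑ i : Fin d, x i * v i.succ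
  map_add' u v := by simp [mul_add, Finset.sum_add_distrib]; ring
  map_smul' t v := by
    simp only [PiLp.smul_apply, smul_eq_mul, RingHom.id_apply, mul_sub, Finset.mul_sum]
    congr 1
    · ring
    · exact Finset.sum_congr rfl fun i _ => by ring

theorem sqDistFunctional_homogenize {d : ℕ} (x y : EuclideanSpace ℝ (Fin d)) :
    sqDistFunctional x (homogenize y) = dist x y ^ 2 - ‖y‖ ^ 2 := by
  rw [dist_eq_norm, norm_sub_sq_real]
  simp [sqDistFunctional, homogenize_zero, homogenize_succ, PiLp.inner_apply, mul_comm]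

/-- The linear function of `y` in homogeneous coordinates that measures whether `∑ i, v i * y i` is
constantly `s`. -/
noncomputable def affineFunctional {d : ℕ} (v : Fin d → ℝ) (s : ℝ) :
    EuclideanSpace ℝ (Fin (d + 1)) →ₗ[ℝ] ℝ where
  toFun y := (∑ i : Fin d, v i * y i.succ) - s * y 0
  map_add' u v := by simp [mul_add, Finset.sum_add_distrib]; ring
  map_smul' t v := by
    simp only [PiLp.smul_apply, smul_eq_mul, RingHom.id_apply, mul_sub, Finset.mul_sum]
    congr 1
    · exact Finset.sum_congr rfl fun i _ => by ring
    · ring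

theorem eq_zero_of_affineFunctional_eq_zero {d : ℕ} {v : Fin d → ℝ} {s : ℝ}
    (h : affineFunctional v s = 0) : v = 0 := by
  funext i
  have := LinearMap.congr_fun h (EuclideanSpace.single i.succ 1)
  simpa [affineFunctional, Pi.single_apply, Fin.succ_ne_zero] using this

/-- A vector of homogeneous coordinates is determined by its first coordinate and, up to a constant,
the values of the functionals of points in general position. -/
theorem eq_of_sqDistFunctional {d : ℕ} {y : Fin (d + 2) → EuclideanSpace ℝ (Fin d)}
    (hy : RelNondegenerate fun i => homogenize (y i)) {u v : EuclideanSpace ℝ (Fin (d + 1))}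
    (h0 : u 0 = v 0) {t : ℝ}
    (h : ∀ j, sqDistFunctional (y j) u = sqDistFunctional (y j) v + t) : u = v := by
  have := eq_zero_of_affineFunctional_eq_zero (hy.functional_eq_zero (by simp)
    (affineFunctional (fun i => u i.succ - v i.succ) (-t / 2)) fun j => by
      have := h j
      simp only [sqDistFunctional, LinearMap.coe_mk, AddHom.coe_mk, h0] at this
      simp only [affineFunctional, LinearMap.coe_mk, AddHom.coe_mk, homogenize_zero,
        homogenize_succ, sub_mul, Finset.sum_sub_distrib, mul_comm _ (y j _)]
      linarith)
  ext i
  refine Fin.cases h0 (fun i => ?_) i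
  exact sub_eq_zero.1 (congrFun this i)

theorem perspectiveInPoint_euclid {d : ℕ} {x y z : Fin (d + 2) → EuclideanSpace ℝ (Fin d)}
    (hx : ¬ Conhyperspherical dist x) (hxy : IsNextGeneration dist x y)
    (hyz : IsNextGeneration dist y z) :
    PerspectiveInPoint (fun i => euclToProj (x i)) (fun i => euclToProj (z i)) := by
  have step : ∀ {P Q : Fin (d + 2) → EuclideanSpace ℝ (Fin d)}, IsNextGeneration dist P Q →
      ∃ c e : Fin (d + 2) → ℝ, ∀ i j,
        sqDistFunctional (P j) (homogenize (Q i)) = c i + if j = i then e i else 0 := by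
    intro P Q h
    refine exists_eq_add_ite (g := fun i j => sqDistFunctional (P j) (homogenize (Q i)))
      fun i => ?_
    obtain ⟨r, hr⟩ := h i
    exact ⟨r ^ 2 - ‖Q i‖ ^ 2, fun j hj => by rw [sqDistFunctional_homogenize, hr j hj]⟩
  obtain ⟨c, e, hce⟩ := step hxy
  obtain ⟨b, f, hbf⟩ := step hyz
  have he : ∀ i, e i ≠ 0 := by
    refine fun i hi => hx ⟨y i, √(c i + ‖y i‖ ^ 2), fun j => ?_⟩
    have := hce i j
    rw [sqDistFunctional_homogenize, hi] at this
    rw [← Real.sqrt_sq (dist_nonneg (x := x j) (y := y i))]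
    congr 1
    simp at this
    linarith
  have hy : RelNondegenerate fun i => homogenize (y i) :=
    relNondegenerate_of_forall_functional (F := fun j => sqDistFunctional (x j)) he hce
  obtain ⟨μ, hμ, hμ0⟩ := hy.exists_rel (by simp)
  have hμ1 : ∑ i, μ i = 0 := by
    have := congrArg (fun v : EuclideanSpace ℝ (Fin (d + 1)) => v 0) hμ
    simpa [homogenize_zero] using this
  have hμ2 : ∀ k, ∑ i, μ i * y i k = 0 := by
    intro k
    have := congrArg (fun v : EuclideanSpace ℝ (Fin (d + 1)) => v k.succ) hμ
    simpa [homogenize_succ] using this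
  have h1 : ∀ j, ∑ i, μ i * c i + μ j * e j = 0 := by
    intro j
    have := congrArg (sqDistFunctional (x j)) hμ
    simpa [hce, mul_add, Finset.sum_add_distrib] using this
  have h2 : ∀ i, μ i * f i = ∑ j, μ j * ‖y j‖ ^ 2 := by
    intro i
    have h : ∑ j, μ j * sqDistFunctional (y j) (homogenize (z i)) = μ i * f i := by
      simp [hbf, mul_add, Finset.sum_add_distrib, ← Finset.sum_mul, hμ1]
    rw [← h]
    simp only [sqDistFunctional, LinearMap.coe_mk, AddHom.coe_mk, homogenize_zero,
      homogenize_succ, mul_sub, Finset.sum_sub_distrib, mul_one, Finset.mul_sum]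
    rw [Finset.sum_comm (s := Finset.univ (α := Fin (d + 2)))]
    have : ∀ k, ∑ j, μ j * (2 * (y j k * z i k)) = 0 := by
      intro k
      have := congrArg (fun t => t * (2 * z i k)) (hμ2 k)
      simp only [Finset.sum_mul, zero_mul] at this
      rw [← this]
      exact Finset.sum_congr rfl fun j _ => by ring
    simp [this]
  refine LinePerspective.perspectiveInPoint (x := fun i => homogenize (x i))
    (z := fun i => homogenize (z i)) ?_ (fun i => homogenize_ne_zero _)
    (fun i => homogenize_ne_zero _)
  by_cases hM : ∑ j, μ j * ‖y j‖ ^ 2 = 0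
  · have hf : ∀ i, f i = 0 := fun i => by simpa [hM, hμ0 i] using h2 i
    refine linePerspective_of_forall_smul_eq 0 (homogenize_ne_zero _) fun i => ⟨1, ?_⟩
    rw [one_smul]
    refine eq_of_sqDistFunctional hy (t := b 0 - b i) ?_ fun j => ?_
    · simp [homogenize_zero]
    · simp [hbf, hf]
  · have hf : ∀ i, f i ≠ 0 := fun i hf => hM (by simp [← h2 i, hf])
    have hS : ∀ i, -e i / f i = (∑ k, μ k * c k) / ∑ j, μ j * ‖y j‖ ^ 2 := by
      intro i
      have := hf i
      rw [div_eq_div_iff this hM, ← h2 i]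
      linear_combination -f i * h1 i
    set β := (∑ k, μ k * c k) / ∑ j, μ j * ‖y j‖ ^ 2 with hβ
    refine linePerspective_of_add_smul_eq 0 (homogenize_ne_zero _) (fun _ => β) fun i => ?_
    have key : ∀ i j, sqDistFunctional (y j) (homogenize (x i) + β • homogenize (z i))
        = c j + ‖y j‖ ^ 2 - ‖x i‖ ^ 2 + β * b i := by
      intro i j
      have hsw : sqDistFunctional (y j) (homogenize (x i))
          = sqDistFunctional (x i) (homogenize (y j)) + ‖y j‖ ^ 2 - ‖x i‖ ^ 2 := by
        rw [sqDistFunctional_homogenize, sqDistFunctional_homogenize, dist_comm]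
        ring
      rw [map_add, map_smul, hsw, hce, hbf, smul_eq_mul]
      by_cases hij : i = j
      · subst hij
        have : β * f i = -e i := by rw [← hS i, div_mul_cancel₀ _ (hf i)]
        simp only [if_true]
        linear_combination this
      · simp only [if_neg hij, if_neg (Ne.symm hij)]
        ring
    refine eq_of_sqDistFunctional hy
      (t := ‖x 0‖ ^ 2 - ‖x i‖ ^ 2 + β * b i - β * b 0) ?_ fun j => ?_
    · simp [homogenize_zero]
    · rw [key, key]
      ring

/-! ### Hyperbolic geometry -/

/-- The Lorentz form as a bilinear form. -/
noncomputable def lorentzForm (d : ℕ) : BilinForm ℝ (EuclideanSpace ℝ (Fin (d + 1))) :=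
  LinearMap.mk₂ ℝ lorentz
    (fun u v w => by simp [lorentz, add_mul, Finset.sum_add_distrib]; ring)
    (fun t u v => by simp [lorentz, mul_add, Finset.mul_sum, mul_assoc])
    (fun u v w => by simp [lorentz, mul_add, Finset.sum_add_distrib]; ring)
    (fun t u v => by simp [lorentz, mul_add, Finset.mul_sum, mul_left_comm])

theorem lorentzForm_apply {d : ℕ} (x y : EuclideanSpace ℝ (Fin (d + 1))) :
    lorentzForm d x y = lorentz x y := rfl

theorem lorentz_comm {d : ℕ} (x y : EuclideanSpace ℝ (Fin (d + 1))) :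
    lorentz x y = lorentz y x := by
  simp [lorentz, mul_comm]

theorem eq_zero_of_lorentzForm_eq_zero {d : ℕ} {v : EuclideanSpace ℝ (Fin (d + 1))}
    (h : lorentzForm d v = 0) : v = 0 := by
  ext i
  refine Fin.cases ?_ (fun i => ?_) i
  · have := LinearMap.congr_fun h (EuclideanSpace.single 0 1)
    simpa [lorentzForm_apply, lorentz] using this
  · have := LinearMap.congr_fun h (EuclideanSpace.single i.succ 1)
    simpa [lorentzForm_apply, lorentz, Pi.single_apply, (Fin.succ_ne_zero _).symm] using this

theorem HypSpace.lorentz_neg {d : ℕ} (x y : HypSpace d) : lorentz x.1 y.1 < 0 := by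
  obtain ⟨x, hx, hx0⟩ := x
  obtain ⟨y, hy, hy0⟩ := y
  have hcs := Finset.sum_mul_sq_le_sq_mul_sq Finset.univ (fun i : Fin d => x i.succ)
    (fun i => y i.succ)
  simp only [lorentz, ← pow_two] at hx hy ⊢
  have hX : ∑ i : Fin d, x i.succ ^ 2 = x 0 ^ 2 - 1 := by linarith
  have hY : ∑ i : Fin d, y i.succ ^ 2 = y 0 ^ 2 - 1 := by linarith
  have hY' : 0 ≤ ∑ i : Fin d, y i.succ ^ 2 := Finset.sum_nonneg fun i _ => sq_nonneg _
  rw [hX, hY] at hcs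
  have : (∑ i : Fin d, x i.succ * y i.succ) ^ 2 < (x 0 * y 0) ^ 2 := by nlinarith
  have := lt_of_pow_lt_pow_left₀ 2 (by positivity) this
  linarith

theorem hypDist_eq_iff {d : ℕ} (p q p' q' : HypSpace d) :
    hypDist p q = hypDist p' q' ↔ lorentzForm d p.1 q.1 = lorentzForm d p'.1 q'.1 := by
  unfold hypDist
  rw [Real.strictMonoOn_arcosh.injOn.eq_iff (by simpa using p.lorentz_neg q)
    (by simpa using p'.lorentz_neg q'), neg_inj]
  rfl

/-! ### Elliptic geometry -/

theorem sphDist_eq_iff {d : ℕ} (p q p' q' : UnitSphere d) :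
    sphDist p q = sphDist p' q' ↔ innerₗ _ p.1 q.1 = innerₗ _ p'.1 q'.1 := by
  have h : ∀ p q : UnitSphere d, Real.cos (sphDist p q) = innerₗ _ p.1 q.1 := fun p q => by
    rw [sphDist, InnerProductGeometry.cos_angle]
    simp
  rw [← h, ← h]
  exact (Real.injOn_cos.eq_iff
    ⟨InnerProductGeometry.angle_nonneg _ _, InnerProductGeometry.angle_le_pi _ _⟩
    ⟨InnerProductGeometry.angle_nonneg _ _, InnerProductGeometry.angle_le_pi _ _⟩).symm

theorem mainTheorem1 (d k : ℕ) (hk : 1 ≤ k) :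
    -- Euclidean geometry
    (∀ N : ℕ → Fin (d + 2) → EuclideanSpace ℝ (Fin d),
      AffNondegenerate (N 1) →
      (∀ j, 1 ≤ j → j ≤ k → ¬ Conhyperspherical dist (N j)) →
      (∀ j, 1 ≤ j → j ≤ k + 1 → IsNextGeneration dist (N j) (N (j + 1))) →
      PerspectiveInPoint (fun i => euclToProj (N k i)) (fun i => euclToProj (N (k + 2) i))) ∧
    -- hyperbolic geometry
    (∀ N : ℕ → Fin (d + 2) → HypSpace d,
      ProjNondegenerate (fun i => hypToProj (N 1 i)) →
      (∀ j, 1 ≤ j → j ≤ k → ¬ Conhyperspherical hypDist (N j)) →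
      (∀ j, 1 ≤ j → j ≤ k + 1 → IsNextGeneration hypDist (N j) (N (j + 1))) →
      PerspectiveInPoint (fun i => hypToProj (N k i)) (fun i => hypToProj (N (k + 2) i))) ∧
    -- elliptic geometry, through unit representatives of the points
    (∀ x : ℕ → Fin (d + 2) → UnitSphere d,
      ProjNondegenerate (fun i => ellToProj (x 1 i)) →
      (∀ j, 1 ≤ j → j ≤ k → ¬ Conhyperspherical sphDist (x j)) →
      (∀ j, 1 ≤ j → j ≤ k + 1 → IsNextGeneration sphDist (x j) (x (j + 1))) →
      PerspectiveInPoint (fun i => ellToProj (x k i)) (fun i => ellToProj (x (k + 2) i))) := by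
  refine ⟨fun N _ hN hstep => ?_, fun N _ hN hstep => ?_, fun x _ hx hstep => ?_⟩
  · exact perspectiveInPoint_euclid (hN k hk le_rfl) (hstep k hk (by omega))
      (hstep (k + 1) (by omega) le_rfl)
  · exact perspectiveInPoint_of_bilinForm (v := Subtype.val) HypSpace.coe_ne_zero lorentz_comm
      (fun _ => eq_zero_of_lorentzForm_eq_zero) hypDist_eq_iff (hN k hk le_rfl)
      (hstep k hk (by omega)) (hstep (k + 1) (by omega) le_rfl)
  · exact perspectiveInPoint_of_bilinForm (v := Subtype.val) UnitSphere.coe_ne_zero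
      (B := innerₗ _) (fun u v => real_inner_comm v u)
      (fun v hv => inner_self_eq_zero.1 (LinearMap.congr_fun hv v)) sphDist_eq_iff
      (hx k hk le_rfl) (hstep k hk (by omega)) (hstep (k + 1) (by omega) le_rfl)
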